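/- For a matroid $M$ on $E=\{1,\dots,n\}$ let $P(M)\subset\mathbb{R}^n$ be its base polytope, the convex hull of the incidence vectors of the bases of $M$. A (nontrivial) hyperplane split of $P(M)$ is a decomposition $P(M)=P(M_1)\cup P(M_2)$, with $M_1,M_2$ matroids on $E$, such that $P(M_1)\cap P(M_2)$ is a face of both $P(M_1)$ and $P(M_2)$ and neither $M_1$ nor $M_2$ has the same bases as $M$. Two hyperplane splits $P(M_1)\cup P(M_2)$ and $P(M_1')\cup P(M_2')$ of $P(M)$ are equivalent if, after possibly exchanging $M_1'$ and $M_2'$, the face lattices of $P(M_i)$ and $P(M_i')$ are isomorphic for $i=1,2$; otherwise they are different. A partition $E=E_1\sqcup E_2$ is good, with integers $a_1,a_2$, if the ranks $r_i>1$ of $M|_{E_i}$ satisfy $0<a_i<r_i$ and $r_1+r_2=r+a_1+a_2$ (where $r$ is the rank of $M$), and $X\cup Y$ is independent in $M$ whenever $X\subseteq E_1$, $Y\subseteq E_2$ are independent in $M$ with $|X|\le r_1-a_1$, $|Y|\le r_2-a_2$. Let $n\ge r+2\ge 4$ be integers, let $U_{n,r}$ be the uniform matroid of rank $r$ on $\{1,\dots,n\}$,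 and let $h(U_{n,r})$ be the number of pairwise different nontrivial hyperplane splits of $P(U_{n,r})$ (the number of equivalence classes). Then $$h(U_{n,r})\ \ge\ \left\lfloor \frac n2\right\rfloor-1 .$$ Moreover, such splits come from the partitions $E_1(k)=\{1,\dots,k\}$, $E_2(k)=\{k+1,\dots,n\}$, $k=2,\dots,\lfloor n/2\rfloor$: for each such $k$ the partition is good for suitable integers $a_1(k),a_2(k)$, and these can be chosen so that the sets $\{B \text{ basis of } U_{n,r}: |B\cap E_i(k)|\le r_i(k)-a_i(k)\}$, $i=1,2$, where $r_i(k)=\min\{|E_i(k)|,r\}$, are the sets of bases of matroids $M_1(k),M_2(k)$ such that $P(U_{n,r})=P(M_1(k))\cup P(M_2(k))$ is a nontrivial hyperplane split, and the splits for different $k$ are different. -/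

import Mathlib

open Set

noncomputable section

namespace MatroidSplit

/-! ### Matroid base polytopes and their faces -/

/-- The base polytope of a matroid on (a subset of) the finite type `α`: the convex hull in `ℝ^α`
of the incidence vectors of the bases. -/
def basePolytope {α : Type*} (M : Matroid α) : Set (α → ℝ) :=
  convexHull ℝ {x | ∃ B : Set α, M.IsBase B ∧ x = B.indicator (fun _ => (1 : ℝ))}

/-- The face lattice of a convex polytope `P`: the empty face together with all the sets on which
some linear functional attains its maximum over `P` (in particular `P` itself), ordered by
inclusion. -/
abbrev FaceLattice {α : Type*} (P : Set (α → ℝ)) : Type _ :=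
  {F : Set (α → ℝ) // F ⊆ P ∧ IsExposed ℝ P F}

/-- Two polytopes are combinatorially equivalent if their face lattices are isomorphic. -/
def CombEquiv {α : Type*} (P Q : Set (α → ℝ)) : Prop :=
  Nonempty (FaceLattice P ≃o FaceLattice Q)

theorem CombEquiv.refl {α : Type*} (P : Set (α → ℝ)) : CombEquiv P P :=
  ⟨OrderIso.refl _⟩

theorem CombEquiv.symm {α : Type*} {P Q : Set (α → ℝ)} (h : CombEquiv P Q) : CombEquiv Q P :=
  h.map OrderIso.symm

theorem CombEquiv.trans {α : Type*} {P Q R : Set (α → ℝ)} (h : CombEquiv P Q)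
    (h' : CombEquiv Q R) : CombEquiv P R :=
  h.elim fun e => h'.elim fun e' => ⟨e.trans e'⟩

/-! ### Hyperplane splits -/

/-- `P(M) = P(M₁) ∪ P(M₂)` is a nontrivial hyperplane split: `M₁`, `M₂` are matroids on the ground
set of `M`, the two base polytopes cover `P(M)`, they meet in a common face, and neither of the
two matroids has the same bases as `M`. -/
structure IsHyperplaneSplit {α : Type*} (M M₁ M₂ : Matroid α) : Prop where
  ground_left : M₁.E = M.E
  ground_right : M₂.E = M.E
  union_eq : basePolytope M = basePolytope M₁ ∪ basePolytope M₂
  face_left : IsExposed ℝ (basePolytope M₁) (basePolytope M₁ ∩ basePolytope M₂)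
  face_right : IsExposed ℝ (basePolytope M₂) (basePolytope M₁ ∩ basePolytope M₂)
  left_nontrivial : {B | M₁.IsBase B} ≠ {B | M.IsBase B}
  right_nontrivial : {B | M₂.IsBase B} ≠ {B | M.IsBase B}

/-- Equivalence of two hyperplane splits `P(M₁) ∪ P(M₂)` and `P(N₁) ∪ P(N₂)` of the same polytope:
after exchanging `N₁` and `N₂` if necessary, `P(Mᵢ)` is combinatorially equivalent to `P(Nᵢ)` for
`i = 1, 2`. Splits that are not equivalent are called different. -/
def SplitEquiv {α : Type*} (M₁ M₂ N₁ N₂ : Matroid α) : Prop :=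
  (CombEquiv (basePolytope M₁) (basePolytope N₁) ∧
      CombEquiv (basePolytope M₂) (basePolytope N₂)) ∨
    (CombEquiv (basePolytope M₁) (basePolytope N₂) ∧
      CombEquiv (basePolytope M₂) (basePolytope N₁))

/-- The nontrivial hyperplane splits of `P(M)`, up to equivalence. -/
def splitSetoid {α : Type*} (M : Matroid α) :
    Setoid {p : Matroid α × Matroid α // IsHyperplaneSplit M p.1 p.2} where
  r p q := SplitEquiv p.1.1 p.1.2 q.1.1 q.1.2
  iseqv :=
    { refl := fun _ => Or.inl ⟨CombEquiv.refl _, CombEquiv.refl _⟩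
      symm := by
        rintro p q (⟨h₁, h₂⟩ | ⟨h₁, h₂⟩)
        · exact Or.inl ⟨h₁.symm, h₂.symm⟩
        · exact Or.inr ⟨h₂.symm, h₁.symm⟩
      trans := by
        rintro p q s (⟨h₁, h₂⟩ | ⟨h₁, h₂⟩) (⟨h₃, h₄⟩ | ⟨h₃, h₄⟩)
        · exact Or.inl ⟨h₁.trans h₃, h₂.trans h₄⟩
        · exact Or.inr ⟨h₁.trans h₃, h₂.trans h₄⟩
        · exact Or.inr ⟨h₁.trans h₄, h₂.trans h₃⟩
        · exact Or.inl ⟨h₁.trans h₄, h₂.trans h₃⟩ }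

/-- `h(M)`: the number of pairwise different nontrivial hyperplane splits of `P(M)`, that is, the
number of equivalence classes. -/
def numDifferentSplits {α : Type*} (M : Matroid α) : ℕ :=
  Nat.card (Quotient (splitSetoid M))

/-! ### Good partitions -/

/-- `(E₁, E₂)` is a good partition of the ground set of `M`, witnessed by the integers `a₁`, `a₂`.
Here `M.eRk Eᵢ` is the rank `rᵢ` of the restriction of `M` to `Eᵢ`, and the condition
`|X| ≤ rᵢ - aᵢ` is written `|X| + aᵢ ≤ rᵢ`. -/
structure IsGoodPartition {α : Type*} (M : Matroid α) (E₁ E₂ : Set α) (a₁ a₂ : ℕ) : Prop where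
  union_eq : E₁ ∪ E₂ = M.E
  disjoint : Disjoint E₁ E₂
  one_lt_rank_left : 1 < M.eRk E₁
  one_lt_rank_right : 1 < M.eRk E₂
  pos_left : 0 < a₁
  lt_left : (a₁ : ℕ∞) < M.eRk E₁
  pos_right : 0 < a₂
  lt_right : (a₂ : ℕ∞) < M.eRk E₂
  rank_add : M.eRk E₁ + M.eRk E₂ = M.eRank + a₁ + a₂
  indep_union : ∀ X Y : Set α, X ⊆ E₁ → Y ⊆ E₂ → M.Indep X → M.Indep Y →
    X.encard + a₁ ≤ M.eRk E₁ → Y.encard + a₂ ≤ M.eRk E₂ → M.Indep (X ∪ Y)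

/-- The pair `(M₁, M₂)` is the one cut out of `M` by the good partition `(E₁, E₂)` with integers
`a₁`, `a₂`: for `i = 1, 2` the bases of `Mᵢ` are the bases `B` of `M` with `|B ∩ Eᵢ| ≤ rᵢ - aᵢ`. -/
structure IsInducedBy {α : Type*} (M : Matroid α) (E₁ E₂ : Set α) (a₁ a₂ : ℕ)
    (M₁ M₂ : Matroid α) : Prop where
  good : IsGoodPartition M E₁ E₂ a₁ a₂
  isBase_left : ∀ B, M₁.IsBase B ↔ M.IsBase B ∧ (B ∩ E₁).encard + a₁ ≤ M.eRk E₁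
  isBase_right : ∀ B, M₂.IsBase B ↔ M.IsBase B ∧ (B ∩ E₂).encard + a₂ ≤ M.eRk E₂

/-! ### Uniform matroids -/

/-- The uniform matroid `U_{n,r}`. Its ground set is `Fin n`, whose elements `0, …, n - 1` stand for
`1, …, n`, and a set is independent iff it has at most `r` elements. -/
def uniformMatroid (n r : ℕ) : Matroid (Fin n) :=
  (IndepMatroid.ofFinite (E := Set.univ) Set.finite_univ (fun I => I.ncard ≤ r)
    (by simp)
    (fun I J hJ hIJ => (Set.ncard_le_ncard hIJ (Set.toFinite J)).trans hJ)
    (fun I J hI hJ hIJ => by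
      obtain ⟨e, heJ, heI⟩ := Set.exists_mem_notMem_of_ncard_lt_ncard hIJ (Set.toFinite I)
      refine ⟨e, heJ, heI, ?_⟩
      rw [Set.ncard_insert_of_notMem heI (Set.toFinite I)]
      omega)
    (fun I _ => Set.subset_univ I)).matroid

/-- For `r ≤ n` the bases of `U_{n,r}` are exactly the `r`-element sets. -/
theorem uniformMatroid_isBase_iff {n r : ℕ} (h : r ≤ n) (B : Set (Fin n)) :
    (uniformMatroid n r).IsBase B ↔ B.ncard = r := by
  have hI : ∀ I, (uniformMatroid n r).Indep I ↔ I.ncard ≤ r := fun I => Iff.rfl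
  rw [Matroid.isBase_iff_maximal_indep]
  constructor
  · intro hB
    refine le_antisymm ((hI B).1 hB.prop) ?_
    by_contra! hlt
    have hex : ∃ e, e ∉ B := by
      by_contra! hall
      have : B = Set.univ := Set.eq_univ_of_forall hall
      rw [this, Set.ncard_univ, Nat.card_fin] at hlt
      omega
    obtain ⟨e, he⟩ := hex
    have hins : (uniformMatroid n r).Indep (insert e B) := by
      rw [hI, Set.ncard_insert_of_notMem he (Set.toFinite B)]
      omega
    exact he (hB.le_of_ge hins (Set.subset_insert e B) (Set.mem_insert e B))
  · intro hB
    refine ⟨(hI B).2 hB.le, fun J hJ hBJ => ?_⟩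
    have hJ' := (hI J).1 hJ
    exact (Set.eq_of_subset_of_ncard_le hBJ (by omega) (Set.toFinite J)).ge

/-- The set of the first `k` elements of the ground set (it stands for `{1, …, k}`). -/
def initialSegment (n k : ℕ) : Set (Fin n) := {i | (i : ℕ) < k}

end MatroidSplit

end

/-! Put S = {1,…,k}. For an integer b the hyperplane x(S) = b cuts the hypersimplex P(U_{n,r}) into
the pieces x(S) ≤ b and x(Sᶜ) ≤ r - b. Each piece has only 0/1 vertices, so it is the base polytope
of the matroid whose bases are the r-sets with at most b elements in S, respectively at most r - b
in Sᶜ (`IsCutMatroid.basePolytope_eq`). With b₁ = b, b₂ = r - b and aᵢ = rᵢ - bᵢ, goodness of the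
partition reduces to b₁ + b₂ = r and strict bounds on b.

The splits are told apart by least vertex degrees. In any base polytope the edges at B correspond to
the single-element exchanges at B (`vertexDegrees_basePolytope`). In the piece given by (S, b) a
vertex off the cut has the full degree r(n - r), while a vertex on it loses the exchanges replacing
an element of B ∖ S by one of S ∖ B. Hence the defect (r - b)(|S| - b) is a combinatorial invariant
(`IsCutMatroid.mul_eq_of_combEquiv`).

Take b = 1 if 2r ≤ n and b = k - 1 otherwise. The left defects (r - 1)(k - 1), respectively r - k +
1, are injective in k, which settles equivalences without exchange. An equivalence with exchange
between k and l gives ck = n - l and cl = n - k, with c = r - 1 or c = n - r - 1; for k ≠ l this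
forces k + l = n, impossible when k, l ≤ n/2. -/

noncomputable section

namespace MatroidSplit

/-! ### Vertex degrees of a lattice of faces -/

/-- The degrees of the atoms of a partially ordered set with a least element, the degree of an atom
being the number of elements that cover it. For the face lattice of a polytope these are the numbers
of edges at its vertices. -/
def vertexDegrees (L : Type*) [PartialOrder L] : Set ℕ :=
  {d | ∃ m a : L, IsBot m ∧ m ⋖ a ∧ d = {c | a ⋖ c}.ncard}

theorem vertexDegrees_subset_of_orderIso {L L' : Type*} [PartialOrder L] [PartialOrder L']
    (e : L ≃o L') : vertexDegrees L ⊆ vertexDegrees L' := by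
  rintro d ⟨m, a, hm, hma, rfl⟩
  refine ⟨e m, e a, fun x => ?_, (apply_covBy_apply_iff e).2 hma, ?_⟩
  · rw [← e.apply_symm_apply x]
    exact e.monotone (hm _)
  · rw [← Set.ncard_image_of_injective _ e.injective]
    congr 1
    ext c
    constructor
    · rintro ⟨c, hc, rfl⟩
      exact (apply_covBy_apply_iff e).2 hc
    · intro hc
      refine ⟨e.symm c, ?_, e.apply_symm_apply c⟩
      rw [Set.mem_ofPred_eq, ← apply_covBy_apply_iff e, e.apply_symm_apply]
      exact hc

theorem CombEquiv.vertexDegrees_eq {α : Type*} {P Q : Set (α → ℝ)} (h : CombEquiv P Q) :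
    vertexDegrees (FaceLattice P) = vertexDegrees (FaceLattice Q) :=
  h.elim fun e => (vertexDegrees_subset_of_orderIso e).antisymm
    (vertexDegrees_subset_of_orderIso e.symm)

/-! ### Exposed faces of convex hulls -/

/-- The open half-space l < m together with the hull of the maximisers is convex and contains V. A
point of the hull of V with l = m must lie in the second part. -/
theorem mem_convexHull_of_apply_eq {E : Type*} [AddCommGroup E] [Module ℝ E]
    {V : Set E} (l : E →ₗ[ℝ] ℝ) {m : ℝ} (hl : ∀ v ∈ V, l v ≤ m) {x : E}
    (hx : x ∈ convexHull ℝ V) (hxm : l x = m) : x ∈ convexHull ℝ {v ∈ V | l v = m} := by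
  set W := {v ∈ V | l v = m}
  have hW : ∀ y ∈ convexHull ℝ W, l y = m := by
    intro y hy
    exact convexHull_min (fun v hv => hv.2) (convex_hyperplane l.isLinear m) hy
  have hconv : Convex ℝ ({y | l y < m} ∪ convexHull ℝ W) := by
    rw [convex_iff_forall_pos]
    have hle : ∀ y ∈ {y | l y < m} ∪ convexHull ℝ W, l y ≤ m := by
      rintro y (hy | hy)
      · exact le_of_lt hy
      · exact (hW y hy).le
    intro y hy z hz a b ha hb hab
    by_cases h : l y < m ∨ l z < m
    · left
      have h1 := hle y hy
      have h2 := hle z hz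
      simp only [mem_ofPred_eq, map_add, map_smul, smul_eq_mul]
      have hm : m = a * m + b * m := by rw [← add_mul, hab, one_mul]
      rcases h with h | h
      · have := mul_lt_mul_of_pos_left h ha
        have := mul_le_mul_of_nonneg_left h2 hb.le
        linarith
      · have := mul_lt_mul_of_pos_left h hb
        have := mul_le_mul_of_nonneg_left h1 ha.le
        linarith
    · push Not at h
      have hy' : y ∈ convexHull ℝ W := hy.resolve_left (not_lt.2 h.1)
      have hz' : z ∈ convexHull ℝ W := hz.resolve_left (not_lt.2 h.2)
      exact Or.inr (convex_convexHull ℝ W hy' hz' ha.le hb.le hab)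
  have hsub : V ⊆ {y | l y < m} ∪ convexHull ℝ W := by
    intro v hv
    rcases (hl v hv).lt_or_eq with h | h
    · exact Or.inl h
    · exact Or.inr (subset_convexHull ℝ W ⟨hv, h⟩)
  rcases convexHull_min hsub hconv hx with h | h
  · exact absurd hxm (ne_of_lt h)
  · exact h

theorem isExposed_convexHull_setOf_eq {E : Type*} [AddCommGroup E] [Module ℝ E]
    [TopologicalSpace E] {V : Set E} (l : StrongDual ℝ E) {m : ℝ} (hl : ∀ v ∈ V, l v ≤ m) :
    IsExposed ℝ (convexHull ℝ V) (convexHull ℝ {v ∈ V | l v = m}) := by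
  rintro ⟨w, hw⟩
  have hle : ∀ y ∈ convexHull ℝ V, l y ≤ m := fun y hy =>
    convexHull_min hl (convex_halfSpace_le l.toLinearMap.isLinear m) hy
  have heq : ∀ y ∈ convexHull ℝ {v ∈ V | l v = m}, l y = m := fun y hy =>
    convexHull_min (fun v hv => hv.2) (convex_hyperplane l.toLinearMap.isLinear m) hy
  have hsub : convexHull ℝ {v ∈ V | l v = m} ⊆ convexHull ℝ V :=
    convexHull_mono (sep_subset _ _)
  refine ⟨l, Subset.antisymm (fun x hx => ⟨hsub hx, fun y hy => ?_⟩) fun x hx => ?_⟩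
  · rw [heq x hx]
    exact hle y hy
  · refine mem_convexHull_of_apply_eq l.toLinearMap hl hx.1 (le_antisymm (hle x hx.1) ?_)
    have := hx.2 w (hsub hw)
    rwa [heq w hw] at this

theorem eq_convexHull_inter_of_isExposed {E : Type*} [AddCommGroup E] [Module ℝ E]
    [TopologicalSpace E] {V F : Set E} (hF : IsExposed ℝ (convexHull ℝ V) F) :
    F = convexHull ℝ (F ∩ V) := by
  rcases F.eq_empty_or_nonempty with rfl | hne
  · simp
  obtain ⟨w, hw⟩ := hne
  obtain ⟨l, rfl⟩ := hF ⟨w, hw⟩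
  have hl : ∀ v ∈ V, l v ≤ l w := fun v hv => hw.2 v (subset_convexHull ℝ V hv)
  have hV : {x ∈ convexHull ℝ V | ∀ y ∈ convexHull ℝ V, l y ≤ l x} ∩ V = {v ∈ V | l v = l w} := by
    ext v
    constructor
    · rintro ⟨hv, hvV⟩
      exact ⟨hvV, le_antisymm (hl v hvV) (hv.2 w hw.1)⟩
    · rintro ⟨hvV, hv⟩
      exact ⟨⟨subset_convexHull ℝ V hvV, fun y hy => (hw.2 y hy).trans hv.ge⟩, hvV⟩
  rw [hV]
  refine Subset.antisymm (fun x hx => ?_) fun x hx => ?_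
  · exact mem_convexHull_of_apply_eq l.toLinearMap hl hx.1
      (le_antisymm (hw.2 x hx.1) (hx.2 w hw.1))
  · have heq : l x = l w :=
      convexHull_min (fun v (hv : v ∈ {v ∈ V | l v = l w}) => hv.2)
        (convex_hyperplane l.toLinearMap.isLinear _) hx
    exact ⟨convexHull_mono (sep_subset _ _) hx, fun y hy => (hw.2 y hy).trans heq.ge⟩

/-! ### Incidence vectors -/

/-- The incidence vector of a set. -/
def incidence {α : Type*} (B : Set α) : α → ℝ := B.indicator fun _ => 1

theorem incidence_injective {α : Type*} : Function.Injective (incidence (α := α)) :=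
  fun _ _ h => Set.indicator_one_inj ℝ h

/-- The set of vertices of the base polytope. -/
def baseVectors {α : Type*} (M : Matroid α) : Set (α → ℝ) := incidence '' {B | M.IsBase B}

theorem basePolytope_eq {α : Type*} (M : Matroid α) :
    basePolytope M = convexHull ℝ (baseVectors M) := by
  unfold basePolytope baseVectors incidence
  congr 1
  ext x
  simp [eq_comm]

theorem incidence_mem {α : Type*} {M : Matroid α} {B : Set α} (hB : M.IsBase B) :
    incidence B ∈ basePolytope M := by
  rw [basePolytope_eq]
  exact subset_convexHull ℝ _ ⟨B, hB, rfl⟩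

/-- The linear functional summing the coordinates in a set. -/
def coordSum {α : Type*} [Finite α] (S : Set α) : StrongDual ℝ (α → ℝ) :=
  ∑ i ∈ S.toFinite.toFinset, ContinuousLinearMap.proj i

theorem coordSum_apply {α : Type*} [Finite α] (S : Set α) (x : α → ℝ) :
    coordSum S x = ∑ i ∈ S.toFinite.toFinset, x i := by
  simp [coordSum]

theorem coordSum_incidence {α : Type*} [Finite α] (S B : Set α) :
    coordSum S (incidence B) = ((B ∩ S).ncard : ℝ) := by
  classical
  rw [coordSum_apply, Set.ncard_eq_toFinset_card _ (Set.toFinite _)]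
  simp only [incidence, Set.indicator_apply, Finset.sum_ite, Finset.sum_const_zero, add_zero,
    Finset.sum_const, nsmul_eq_mul, mul_one]
  congr 2
  ext i
  simp [and_comm]

/-! ### Vertices and edges of base polytopes -/

/-- Let C be the fundamental circuit of e in B'. If C ∖ {e} lay in the closure of B ∖ {e}, so would
e, contradicting independence of B. An f in C ∖ {e} outside that closure serves both exchanges. -/
theorem exists_symmetric_exchange {α : Type*} {M : Matroid α} {B B' : Set α} (hB : M.IsBase B)
    (hB' : M.IsBase B') {e : α} (he : e ∈ B \ B') :
    ∃ f ∈ B' \ B, M.IsBase (insert f (B \ {e})) ∧ M.IsBase (insert e (B' \ {f})) := by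
  have heE : e ∈ M.E := hB.subset_ground he.1
  have hcl : e ∈ M.closure B' := by rwa [hB'.closure_eq]
  have hC := hB'.indep.fundCircuit_isCircuit hcl he.2
  set C := M.fundCircuit e B'
  have heC : e ∈ C := M.mem_fundCircuit e B'
  have hnot : ¬ C \ {e} ⊆ M.closure (B \ {e}) := by
    intro h
    have h1 : e ∈ M.closure (C \ {e}) := hC.mem_closure_sdiff_singleton_of_mem heC
    have h2 := M.closure_subset_closure_of_subset_closure h h1
    exact hB.indep.notMem_closure_sdiff_of_mem he.1 h2
  obtain ⟨f, ⟨hfC, hfe⟩, hf⟩ := Set.not_subset.1 hnot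
  have hfB' : f ∈ B' := (M.fundCircuit_subset_insert e B' hfC).resolve_left hfe
  have hfE : f ∈ M.E := hB'.subset_ground hfB'
  have hfB : f ∉ B := fun h => hf (M.mem_closure_of_mem' ⟨h, hfe⟩)
  refine ⟨f, ⟨hfB', hfB⟩, ?_, ?_⟩
  · exact hB.exchange_isBase_of_indep hfB
      (((hB.indep.sdiff {e}).notMem_closure_iff_of_notMem (fun h => hfB h.1) hfE).1 hf)
  · refine hB'.exchange_isBase_of_indep he.2 ?_
    rw [Set.insert_sdiff_singleton_comm (ne_of_mem_of_not_mem he.1 hfB)]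
    exact (hB'.indep.mem_fundCircuit_iff hcl he.2).1 hfC

section BasePolytope

variable {α : Type*} {M : Matroid α} {B B' : Set α}

/-- The exchanges `(e, f)` at a base `B`: removing `e` from `B` and adding `f` gives a base. -/
def exchanges {α : Type*} (M : Matroid α) (B : Set α) : Set (α × α) :=
  {p | p.1 ∈ B ∧ p.2 ∉ B ∧ M.IsBase (insert p.2 (B \ {p.1}))}

theorem isBase_eq_of_ncard_inter [Finite α] (hB : M.IsBase B) (hB' : M.IsBase B')
    (h : B.ncard ≤ (B' ∩ B).ncard) : B' = B := by
  have h1 : B' ∩ B = B := Set.eq_of_subset_of_ncard_le inter_subset_right h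
  exact (hB.eq_of_subset_isBase hB' (inter_eq_right.1 h1)).symm

theorem isExposed_vertex [Finite α] (hB : M.IsBase B) : IsExposed ℝ (basePolytope M) {incidence B} := by
  have hl : ∀ v ∈ baseVectors M, coordSum B v ≤ (B.ncard : ℝ) := by
    rintro _ ⟨C, hC, rfl⟩
    rw [coordSum_incidence]
    exact_mod_cast Set.ncard_le_ncard inter_subset_right
  have := isExposed_convexHull_setOf_eq (coordSum B) hl
  suffices h : {v ∈ baseVectors M | coordSum B v = (B.ncard : ℝ)} = {incidence B} by
    rwa [h, convexHull_singleton, ← basePolytope_eq] at this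
  symm
  ext v
  constructor
  · rintro rfl
    refine ⟨⟨B, hB, rfl⟩, ?_⟩
    rw [coordSum_incidence, inter_self]
  · rintro ⟨⟨C, hC, rfl⟩, h⟩
    rw [coordSum_incidence, Nat.cast_inj] at h
    rw [isBase_eq_of_ncard_inter hB hC h.ge, mem_singleton_iff]

/-- For the exchanged base B', the functional C ↦ |C ∩ B| + |C ∩ B'| is at most 2|B| - 1 on bases,
because |B ∩ B'| = |B| - 1. Equality makes one term full, so C is B or B'. -/
theorem isExposed_edge [Finite α] (hB : M.IsBase B) {p : α × α} (hp : p ∈ exchanges M B) :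
    IsExposed ℝ (basePolytope M)
      (segment ℝ (incidence B) (incidence (insert p.2 (B \ {p.1})))) := by
  obtain ⟨e, f⟩ := p
  obtain ⟨he, hf, hB'⟩ := hp
  dsimp only at he hf hB' ⊢
  have hcard : (insert f (B \ {e})).ncard = B.ncard := Set.ncard_exchange hf he
  have hpos : 0 < B.ncard := (Set.ncard_pos).2 ⟨e, he⟩
  have hBB' : B ∩ insert f (B \ {e}) = B \ {e} := by
    ext x
    simp only [mem_inter_iff, mem_insert_iff, mem_sdiff, mem_singleton_iff]
    constructor
    · rintro ⟨h1, rfl | h2⟩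
      · exact absurd h1 hf
      · exact h2
    · exact fun h => ⟨h.1, Or.inr h⟩
  have hinter : (B ∩ insert f (B \ {e})).ncard + 1 = B.ncard := by
    rw [hBB']
    exact Set.ncard_sdiff_singleton_add_one he
  set B' := insert f (B \ {e}) with hB'def
  have hval : ∀ C, (coordSum B + coordSum B') (incidence C)
      = (((C ∩ B).ncard + (C ∩ B').ncard : ℕ) : ℝ) := by
    intro C
    rw [add_apply, coordSum_incidence, coordSum_incidence, Nat.cast_add]
  have hle : ∀ C, M.IsBase C → (C ∩ B).ncard + (C ∩ B').ncard ≤ 2 * B.ncard - 1 := by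
    intro C hC
    have h1 : (C ∩ B).ncard ≤ B.ncard := Set.ncard_le_ncard inter_subset_right
    have h2 : (C ∩ B').ncard ≤ B'.ncard := Set.ncard_le_ncard inter_subset_right
    by_cases h : (C ∩ B).ncard = B.ncard
    · obtain rfl := isBase_eq_of_ncard_inter hB hC h.ge
      omega
    · omega
  have hl : ∀ v ∈ baseVectors M, (coordSum B + coordSum B') v ≤ ((2 * B.ncard - 1 : ℕ) : ℝ) := by
    rintro _ ⟨C, hC, rfl⟩
    rw [hval]
    exact_mod_cast hle C hC
  have := isExposed_convexHull_setOf_eq (coordSum B + coordSum B') hl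
  suffices h : {v ∈ baseVectors M |
      (coordSum B + coordSum B') v = ((2 * B.ncard - 1 : ℕ) : ℝ)} =
        {incidence B, incidence B'} by
    rwa [h, convexHull_pair, ← basePolytope_eq] at this
  symm
  ext v
  constructor
  · rintro (rfl | rfl)
    · refine ⟨⟨B, hB, rfl⟩, ?_⟩
      rw [hval, inter_self, Nat.cast_inj]
      omega
    · refine ⟨⟨B', hB', rfl⟩, ?_⟩
      rw [hval, inter_self, Nat.cast_inj, inter_comm]
      omega
  · rintro ⟨⟨C, hC, rfl⟩, h⟩
    rw [hval, Nat.cast_inj] at h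
    have h1 : (C ∩ B).ncard ≤ B.ncard := Set.ncard_le_ncard inter_subset_right
    have h2 : (C ∩ B').ncard ≤ B'.ncard := Set.ncard_le_ncard inter_subset_right
    by_cases h3 : (C ∩ B).ncard = B.ncard
    · left
      rw [isBase_eq_of_ncard_inter hB hC h3.ge]
    · right
      rw [mem_singleton_iff, isBase_eq_of_ncard_inter hB' hC (by omega)]

/-- The vertex of a base polytope given by a base, as a face. -/
def vertexFace [Finite α] (hB : M.IsBase B) : FaceLattice (basePolytope M) :=
  ⟨{incidence B}, (isExposed_vertex hB).subset, isExposed_vertex hB⟩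

theorem face_eq_convexHull {F : Set (α → ℝ)} (hF : IsExposed ℝ (basePolytope M) F) :
    F = convexHull ℝ (F ∩ baseVectors M) := by
  rw [basePolytope_eq] at hF
  exact eq_convexHull_inter_of_isExposed hF

theorem exists_incidence_mem {F : FaceLattice (basePolytope M)} (hF : F.1.Nonempty) :
    ∃ B, M.IsBase B ∧ incidence B ∈ F.1 := by
  have h := face_eq_convexHull F.2.2
  rw [h, convexHull_nonempty_iff] at hF
  obtain ⟨_, hv, B, hB, rfl⟩ := hF
  exact ⟨B, hB, hv⟩

theorem exists_incidence_mem_ne {F : FaceLattice (basePolytope M)} {x : α → ℝ} (hF : {x} < F.1) :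
    ∃ B, M.IsBase B ∧ incidence B ∈ F.1 ∧ incidence B ≠ x := by
  by_contra! hall
  have h := face_eq_convexHull F.2.2
  refine hF.not_ge ?_
  rw [h, ← convexHull_singleton (𝕜 := ℝ) x]
  refine convexHull_mono ?_
  rintro _ ⟨hv, B, hB, rfl⟩
  exact hall B hB hv

theorem isBot_faceLattice_iff (m : FaceLattice (basePolytope M)) : IsBot m ↔ m.1 = ∅ := by
  constructor
  · intro h
    exact subset_empty_iff.1 (h ⟨∅, empty_subset _, isExposed_empty⟩)
  · intro h F
    change m.1 ⊆ F.1
    rw [h]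
    exact empty_subset _

theorem isBot_covBy_iff [Finite α] {m a : FaceLattice (basePolytope M)} (hm : IsBot m) :
    m ⋖ a ↔ ∃ (B : Set α) (hB : M.IsBase B), a = vertexFace hB := by
  have hm' := (isBot_faceLattice_iff m).1 hm
  constructor
  · intro h
    have hne : a.1.Nonempty := by
      rw [nonempty_iff_ne_empty]
      intro h0
      exact h.lt.ne (Subtype.ext (hm'.trans h0.symm))
    obtain ⟨B, hB, hmem⟩ := exists_incidence_mem hne
    refine ⟨B, hB, ?_⟩
    have hle : vertexFace hB ≤ a := singleton_subset_iff.2 hmem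
    have hlt : m < vertexFace hB := by
      refine lt_of_le_of_ne (hm _) fun h0 => ?_
      have : m.1 = {incidence B} := congrArg Subtype.val h0
      rw [hm'] at this
      exact (singleton_ne_empty _).symm this
    exact ((h.eq_or_eq hlt.le hle).resolve_left hlt.ne').symm
  · rintro ⟨B, hB, rfl⟩
    refine ⟨lt_of_le_of_ne (hm _) fun h0 => ?_, fun c hc hcB => ?_⟩
    · have : m.1 = {incidence B} := congrArg Subtype.val h0
      rw [hm'] at this
      exact (singleton_ne_empty _).symm this
    · have h1 : c.1 ⊆ {incidence B} := hcB.le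
      rcases subset_singleton_iff_eq.1 h1 with h2 | h2
      · exact hc.ne (Subtype.ext (hm'.trans h2.symm))
      · exact hcB.ne (Subtype.ext h2)

/-- Symmetric exchange rewrites the sum of two vertices of F as the sum of two other vertices. A
functional maximal at the first two is maximal at the others as well. So every face properly above a
vertex contains an exchange neighbour, and no edges arise otherwise. -/
theorem exists_exchange_mem [Finite α] (hB : M.IsBase B) {F : FaceLattice (basePolytope M)}
    (hF : vertexFace hB < F) :
    ∃ p ∈ exchanges M B, incidence (insert p.2 (B \ {p.1})) ∈ F.1 := by
  obtain ⟨B', hB', hmem, hne⟩ := exists_incidence_mem_ne (F := F) hF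
  have hBF : incidence B ∈ F.1 := hF.le rfl
  have hBB' : ¬ B ⊆ B' := fun h => hne (by rw [hB.eq_of_subset_isBase hB' h])
  obtain ⟨e, he, he'⟩ := Set.not_subset.1 hBB'
  obtain ⟨f, ⟨hf', hf⟩, h1, h2⟩ := exists_symmetric_exchange hB hB' ⟨he, he'⟩
  refine ⟨(e, f), ⟨he, hf, h1⟩, ?_⟩
  obtain ⟨l, hl⟩ := F.2.2 ⟨_, hBF⟩
  have hsum : incidence (insert f (B \ {e})) + incidence (insert e (B' \ {f}))
      = incidence B + incidence B' := by
    classical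
    have hef : e ≠ f := ne_of_mem_of_not_mem he hf
    ext x
    simp only [incidence, Pi.add_apply, Set.indicator_apply, mem_insert_iff, mem_sdiff,
      mem_singleton_iff]
    by_cases hxe : x = e
    · subst hxe
      simp [he, he', hef]
    · by_cases hxf : x = f
      · subst hxf
        simp [hf, hf', hxe]
      · simp [hxe, hxf]
  have hlsum := congrArg l hsum
  rw [map_add, map_add] at hlsum
  have hBF' := hBF
  rw [hl] at hmem hBF' ⊢
  have a1 := hmem.2 _ (incidence_mem h2)
  have a3 := hBF'.2 _ (incidence_mem hB')
  have a4 := hmem.2 _ (incidence_mem hB)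
  refine ⟨incidence_mem h1, fun y hy => (hBF'.2 y hy).trans ?_⟩
  linarith

theorem covBy_edge [Finite α] (hB : M.IsBase B) {p : α × α} (hp : p ∈ exchanges M B)
    {F : FaceLattice (basePolytope M)}
    (hF : F.1 = segment ℝ (incidence B) (incidence (insert p.2 (B \ {p.1})))) :
    vertexFace hB ⋖ F := by
  set w := incidence (insert p.2 (B \ {p.1})) with hw
  have hwne : w ≠ incidence B := by
    intro h
    have h2 := incidence_injective h
    exact hp.2.1 (h2 ▸ mem_insert _ _)
  have hle : vertexFace hB ≤ F := by
    change {incidence B} ⊆ F.1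
    rw [hF, singleton_subset_iff]
    exact left_mem_segment ℝ _ _
  have hwF : w ∈ F.1 := by
    rw [hF]
    exact right_mem_segment ℝ _ _
  refine ⟨lt_of_le_not_ge hle fun h => hwne (h hwF), fun G hG hGF => hGF.not_ge ?_⟩
  change F.1 ⊆ G.1
  obtain ⟨x, hxG, hx⟩ := exists_of_ssubset (show {incidence B} ⊂ G.1 from hG)
  have hBG : incidence B ∈ G.1 := hG.le rfl
  have hxseg : x ∈ segment ℝ (incidence B) w := hF ▸ hGF.le hxG
  have hwG : w ∈ G.1 := by
    rw [← insert_endpoints_openSegment] at hxseg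
    rcases hxseg with h | h | h
    · exact absurd h hx
    · rwa [← h]
    -- Exposed faces are extreme: a point of G interior to the edge pulls in its far endpoint.
    · exact (G.2.2.isExtreme).right_mem_of_mem_openSegment (G.2.1 hBG)
        (F.2.1 hwF) hxG h
  rw [hF]
  exact (G.2.2.convex (convex_convexHull ℝ _)).segment_subset hBG hwG

theorem covBy_vertexFace_iff [Finite α] (hB : M.IsBase B) (F : FaceLattice (basePolytope M)) :
    vertexFace hB ⋖ F ↔ ∃ p ∈ exchanges M B,
      segment ℝ (incidence B) (incidence (insert p.2 (B \ {p.1}))) = F.1 := by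
  constructor
  · intro h
    obtain ⟨p, hp, hmem⟩ := exists_exchange_mem hB h.lt
    refine ⟨p, hp, ?_⟩
    have hexp := isExposed_edge hB hp
    let G : FaceLattice (basePolytope M) := ⟨_, hexp.subset, hexp⟩
    have hG : vertexFace hB ⋖ G := covBy_edge hB hp rfl
    have hGF : G ≤ F :=
      (F.2.2.convex (convex_convexHull ℝ _)).segment_subset
        (h.le rfl) hmem
    exact congrArg Subtype.val ((h.eq_or_eq hG.le hGF).resolve_left hG.lt.ne')
  · rintro ⟨p, hp, h⟩
    exact covBy_edge hB hp h.symm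

/-- Along the segment of (e, f) every coordinate in B other than e stays 1 and every coordinate
outside B other than f stays 0, so the segment determines the exchange. -/
theorem injOn_edge :
    InjOn (fun p : α × α => segment ℝ (incidence B) (incidence (insert p.2 (B \ {p.1}))))
      (exchanges M B) := by
  rintro ⟨e, f⟩ ⟨he, hf, -⟩ ⟨e', f'⟩ ⟨he', hf', -⟩ h
  dsimp only at he hf he' hf' h
  have hmem : incidence (insert f' (B \ {e'})) ∈
      segment ℝ (incidence B) (incidence (insert f (B \ {e}))) := by
    rw [h]
    exact right_mem_segment ℝ _ _
  obtain ⟨a, b, -, -, hab, hx⟩ := hmem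
  have hval : ∀ i, a * incidence B i + b * incidence (insert f (B \ {e})) i
      = incidence (insert f' (B \ {e'})) i := fun i => congrFun hx i
  have h1 : ∀ {C : Set α} {i : α}, i ∈ C → incidence C i = 1 :=
    fun hi => Set.indicator_of_mem hi _
  have h0 : ∀ {C : Set α} {i : α}, i ∉ C → incidence C i = 0 :=
    fun hi => Set.indicator_of_notMem hi _
  have hef' : e' ≠ f' := ne_of_mem_of_not_mem he' hf'
  have hee : e' = e := by
    by_contra hne
    have := hval e'
    rw [h1 he', h1 (mem_insert_of_mem f (show e' ∈ B \ {e} from ⟨he', hne⟩)), h0 (by simp [hef'])] at this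
    linarith
  have hff : f' = f := by
    by_contra hne
    have := hval f'
    rw [h0 hf', h0 (by simp [hne, hf']), h1 (mem_insert _ _)] at this
    linarith
  rw [hee, hff]

/-- The vertex degrees of a base polytope: the edges at the vertex of `B` correspond to the
exchanges at `B`. -/
theorem vertexDegrees_basePolytope [Finite α] (M : Matroid α) :
    vertexDegrees (FaceLattice (basePolytope M)) =
      {d | ∃ B, M.IsBase B ∧ d = (exchanges M B).ncard} := by
  have key : ∀ {B : Set α} (hB : M.IsBase B),
      {c | vertexFace hB ⋖ c}.ncard = (exchanges M B).ncard := by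
    intro B hB
    rw [← Set.ncard_image_of_injective _ Subtype.val_injective,
      ← (injOn_edge (M := M) (B := B)).ncard_image]
    congr 1
    ext s
    constructor
    · rintro ⟨F, hF, rfl⟩
      exact (covBy_vertexFace_iff hB F).1 hF
    · rintro ⟨p, hp, rfl⟩
      have hexp := isExposed_edge hB hp
      let G : FaceLattice (basePolytope M) := ⟨_, hexp.subset, hexp⟩
      have hG : vertexFace hB ⋖ G := covBy_edge hB hp rfl
      exact ⟨G, hG, rfl⟩
  ext d
  constructor
  · rintro ⟨m, a, hm, hma, rfl⟩
    obtain ⟨B, hB, rfl⟩ := (isBot_covBy_iff hm).1 hma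
    exact ⟨B, hB, key hB⟩
  · rintro ⟨B, hB, rfl⟩
    have hbot : IsBot (⟨∅, empty_subset _, isExposed_empty⟩ : FaceLattice (basePolytope M)) :=
      (isBot_faceLattice_iff _).2 rfl
    exact ⟨_, vertexFace hB, hbot, (isBot_covBy_iff hbot).2 ⟨B, hB, rfl⟩, (key hB).symm⟩

end BasePolytope

/-! ### Matroids cut out of a uniform matroid -/

/-- The bases of `M` are the `r`-element sets having at most `b` elements in `S`. -/
structure IsCutMatroid {α : Type*} (M : Matroid α) (r : ℕ) (S : Set α) (b : ℕ) : Prop where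
  ground : M.E = univ
  isBase_iff : ∀ B, M.IsBase B ↔ B.ncard = r ∧ (B ∩ S).ncard ≤ b

theorem ncard_exchange_inter_of_mem {α : Type*} [Finite α] {B S : Set α} {e f : α} (he : e ∈ B)
    (heS : e ∈ S) : (insert f (B \ {e}) ∩ S).ncard ≤ (B ∩ S).ncard := by
  have h1 : insert f (B \ {e}) ∩ S ⊆ insert f ((B ∩ S) \ {e}) := by
    rintro x ⟨rfl | hx, hxS⟩
    · exact mem_insert _ _
    · exact mem_insert_of_mem _ ⟨⟨hx.1, hxS⟩, hx.2⟩
  have h2 := Set.ncard_le_ncard h1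
  have h3 := Set.ncard_insert_le f ((B ∩ S) \ {e})
  have h4 := Set.ncard_sdiff_singleton_add_one (show e ∈ B ∩ S from ⟨he, heS⟩)
  omega

theorem ncard_exchange_inter_of_notMem {α : Type*} [Finite α] {B S : Set α} {e f : α}
    (hfS : f ∉ S) : (insert f (B \ {e}) ∩ S).ncard ≤ (B ∩ S).ncard := by
  refine Set.ncard_le_ncard ?_
  rintro x ⟨rfl | hx, hxS⟩
  · exact absurd hxS hfS
  · exact ⟨hx.1, hxS⟩

theorem ncard_exchange_inter {α : Type*} [Finite α] {B S : Set α} {e f : α} (heS : e ∉ S)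
    (hf : f ∉ B) (hfS : f ∈ S) : (insert f (B \ {e}) ∩ S).ncard = (B ∩ S).ncard + 1 := by
  rw [← Set.ncard_insert_of_notMem (show f ∉ B ∩ S from fun h => hf h.1)]
  congr 1
  ext x
  simp only [mem_inter_iff, mem_insert_iff, mem_sdiff, mem_singleton_iff]
  constructor
  · rintro ⟨rfl | hx, hxS⟩
    · exact Or.inl rfl
    · exact Or.inr ⟨hx.1, hxS⟩
  · rintro (rfl | hx)
    · exact ⟨Or.inl rfl, hfS⟩
    · exact ⟨Or.inr ⟨hx.1, fun h => heS (h ▸ hx.2)⟩, hx.2⟩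

theorem exists_isCutMatroid {α : Type*} [Finite α] {r b : ℕ} {S : Set α}
    (hex : ∃ B : Set α, B.ncard = r ∧ (B ∩ S).ncard ≤ b) :
    ∃ M : Matroid α, IsCutMatroid M r S b := by
  refine ⟨Matroid.ofIsBaseOfFinite (E := univ) (Set.toFinite _)
    (fun B => B.ncard = r ∧ (B ∩ S).ncard ≤ b) hex ?_ (fun B _ => subset_univ B), rfl,
    fun B => Iff.rfl⟩
  rintro B B' ⟨hB, hBS⟩ ⟨hB', hBS'⟩ e ⟨he, he'⟩
  have hne : (B' \ B).Nonempty := by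
    rw [nonempty_iff_ne_empty, Ne, Set.sdiff_eq_empty]
    intro h
    have := Set.eq_of_subset_of_ncard_le h (by omega)
    exact he' (this ▸ he)
  have hcard : ∀ f ∉ B, (insert f (B \ {e})).ncard = r := fun f hf => by
    rw [Set.ncard_exchange hf he, hB]
  by_cases heS : e ∈ S
  · obtain ⟨f, hf⟩ := hne
    exact ⟨f, hf, hcard f hf.2, (ncard_exchange_inter_of_mem he heS).trans hBS⟩
  by_cases hfS : ∃ f ∈ B' \ B, f ∉ S
  · obtain ⟨f, hf, hfS⟩ := hfS
    exact ⟨f, hf, hcard f hf.2, (ncard_exchange_inter_of_notMem hfS).trans hBS⟩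
  push Not at hfS
  obtain ⟨f, hf⟩ := hne
  refine ⟨f, hf, hcard f hf.2, ?_⟩
  rw [ncard_exchange_inter heS hf.2 (hfS f hf)]
  -- Here e ∉ S and B' ∖ B ⊆ S, so B' ∖ S lies in B ∖ S and misses e. Hence |B ∩ S| < |B' ∩ S| ≤ b,
  -- which leaves room for one more element of S.
  have h1 : (B' \ S).ncard < (B \ S).ncard := by
    refine Set.ncard_lt_ncard ⟨fun x hx => ?_, fun h => he' (h ⟨he, heS⟩).1⟩
    by_contra hxB
    exact hx.2 (hfS x ⟨hx.1, fun h => hxB ⟨h, hx.2⟩⟩)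
  have h2 := Set.ncard_inter_add_ncard_sdiff_eq_ncard B S
  have h3 := Set.ncard_inter_add_ncard_sdiff_eq_ncard B' S
  omega

/-! ### Inequalities for the base polytope of a cut matroid -/

/-- If all other coordinates in T were 0 or 1, then x i would be an integer strictly between 0 and
1. -/
theorem exists_ne_fractional {α : Type*} [Finite α] {x : α → ℝ} (hx : ∀ i, 0 ≤ x i ∧ x i ≤ 1)
    {T : Set α} {m : ℤ} (hT : coordSum T x = m) {i : α} (hi : i ∈ T) (h0 : 0 < x i)
    (h1 : x i < 1) : ∃ j ∈ T, j ≠ i ∧ 0 < x j ∧ x j < 1 := by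
  classical
  by_contra! hall
  have hint : ∀ j ∈ T.toFinite.toFinset.erase i, x j = ((if x j = 0 then 0 else 1 : ℤ) : ℝ) := by
    intro j hj
    rw [Finset.mem_erase, Set.Finite.mem_toFinset] at hj
    split_ifs with h
    · rw [h, Int.cast_zero]
    · rw [Int.cast_one]
      exact le_antisymm (hx j).2 (hall j hj.2 hj.1 (lt_of_le_of_ne (hx j).1 (Ne.symm h)))
  rw [coordSum_apply, ← Finset.add_sum_erase _ _ (T.toFinite.mem_toFinset.2 hi),
    Finset.sum_congr rfl hint, ← Int.cast_sum] at hT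
  set z := ∑ j ∈ T.toFinite.toFinset.erase i, (if x j = 0 then 0 else 1 : ℤ)
  have hxi : x i = ((m - z : ℤ) : ℝ) := by
    rw [Int.cast_sub]
    linarith
  rw [hxi] at h0 h1
  have h0' : 0 < m - z := by exact_mod_cast h0
  have h1' : m - z < 1 := by exact_mod_cast h1
  omega

/-- The points of the hypersimplex whose coordinates in `S` sum to at most `b`. -/
def cutHypersimplex {α : Type*} [Finite α] (r : ℕ) (S : Set α) (b : ℕ) : Set (α → ℝ) :=
  {x | (∀ i, 0 ≤ x i ∧ x i ≤ 1) ∧ coordSum univ x = r ∧ coordSum S x ≤ b}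

theorem convex_cutHypersimplex {α : Type*} [Finite α] (r : ℕ) (S : Set α) (b : ℕ) :
    Convex ℝ (cutHypersimplex r S b) := by
  have h : cutHypersimplex r S b = Icc 0 1 ∩ ({x | coordSum univ x = r} ∩ {x | coordSum S x ≤ b}) := by
    ext x
    simp [cutHypersimplex, Pi.le_def, forall_and]
  rw [h]
  exact (convex_Icc 0 1).inter ((convex_hyperplane (coordSum univ).toLinearMap.isLinear _).inter
    (convex_halfSpace_le (coordSum S).toLinearMap.isLinear _))

theorem isCompact_cutHypersimplex {α : Type*} [Finite α] (r : ℕ) (S : Set α) (b : ℕ) :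
    IsCompact (cutHypersimplex r S b) := by
  have h : cutHypersimplex r S b = Icc 0 1 ∩ ({x | coordSum univ x = r} ∩ {x | coordSum S x ≤ b}) := by
    ext x
    simp [cutHypersimplex, Pi.le_def, forall_and]
  rw [h]
  exact isCompact_Icc.inter_right ((isClosed_eq (coordSum univ).continuous continuous_const).inter
    (isClosed_le (coordSum S).continuous continuous_const))

theorem coordSum_single {α : Type*} [Finite α] [DecidableEq α] (S : Set α) (i : α) (t : ℝ) :
    coordSum S (Pi.single i t) = S.indicator (fun _ => t) i := by
  classical
  simp [coordSum_apply, Pi.single_apply, Set.indicator_apply]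

/-- Small moves in both directions along the difference of the i-th and j-th unit vectors stay
inside: the total is unchanged, and x(S) is either unchanged or has slack. So x is a proper
midpoint. -/
theorem not_extreme_of_fractional {α : Type*} [Finite α] {r b : ℕ} {S : Set α} {x : α → ℝ}
    (hx : x ∈ (cutHypersimplex r S b).extremePoints ℝ) {i j : α} (hij : j ≠ i)
    (hi0 : 0 < x i) (hi1 : x i < 1) (hj0 : 0 < x j) (hj1 : x j < 1)
    (h : (i ∈ S ↔ j ∈ S) ∨ coordSum S x < b) : False := by
  classical
  obtain ⟨⟨hx01, hxr, hxb⟩, hext⟩ := hx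
  set d : α → ℝ := Pi.single i 1 - Pi.single j 1 with hd
  have hdu : coordSum univ d = 0 := by
    rw [hd, map_sub, coordSum_single, coordSum_single]
    simp
  have hdS : |coordSum S d| ≤ 1 := by
    rw [hd, map_sub, coordSum_single, coordSum_single, Set.indicator_apply, Set.indicator_apply]
    split_ifs <;> norm_num
  have hdS0 : (i ∈ S ↔ j ∈ S) → coordSum S d = 0 := by
    intro h
    rw [hd, map_sub, coordSum_single, coordSum_single, Set.indicator_apply, Set.indicator_apply]
    simp [h]
  obtain ⟨ε, hε, h1, h2, h3, h4, h5⟩ : ∃ ε : ℝ, 0 < ε ∧ ε ≤ x i ∧ ε ≤ 1 - x i ∧ ε ≤ x j ∧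
      ε ≤ 1 - x j ∧ (coordSum S x < b → ε ≤ b - coordSum S x) := by
    by_cases hb : coordSum S x < b
    · refine ⟨min (min (x i) (1 - x i)) (min (min (x j) (1 - x j)) (b - coordSum S x)), ?_, ?_⟩
      · simp only [lt_min_iff, sub_pos]
        exact ⟨⟨hi0, hi1⟩, ⟨hj0, hj1⟩, hb⟩
      · simp
    · refine ⟨min (min (x i) (1 - x i)) (min (x j) (1 - x j)), ?_, ?_⟩
      · simp only [lt_min_iff, sub_pos]
        exact ⟨⟨hi0, hi1⟩, hj0, hj1⟩
      · simp [hb]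
  have hmem : ∀ t : ℝ, |t| ≤ ε → x + t • d ∈ cutHypersimplex r S b := by
    intro t ht
    obtain ⟨ht1, ht2⟩ := abs_le.1 ht
    refine ⟨fun l => ?_, ?_, ?_⟩
    · simp only [hd, Pi.add_apply, Pi.smul_apply, Pi.sub_apply, smul_eq_mul]
      by_cases hli : l = i
      · subst hli
        rw [Pi.single_eq_same, Pi.single_eq_of_ne hij.symm]
        constructor <;> linarith
      · by_cases hlj : l = j
        · subst hlj
          rw [Pi.single_eq_same, Pi.single_eq_of_ne hli]
          constructor <;> linarith
        · rw [Pi.single_eq_of_ne hli, Pi.single_eq_of_ne hlj]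
          simpa using hx01 l
    · rw [map_add, map_smul, hdu, hxr, smul_zero, add_zero]
    · rw [map_add, map_smul, smul_eq_mul]
      rcases h with h | h
      · rw [hdS0 h, mul_zero, add_zero]
        exact hxb
      · have := (le_abs_self (t * coordSum S d)).trans_eq (abs_mul t _)
        have := mul_le_mul ht hdS (abs_nonneg _) hε.le
        have := h5 h
        linarith
  have hxy := hext (hmem ε (abs_of_pos hε).le) (hmem (-ε) (by rw [abs_neg, abs_of_pos hε]))
    ⟨1 / 2, 1 / 2, by norm_num, by norm_num, by norm_num, by
      ext l
      simp only [Pi.add_apply, Pi.smul_apply, smul_eq_mul]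
      ring⟩
  have := congrFun hxy i
  simp only [hd, Pi.add_apply, Pi.smul_apply, Pi.sub_apply, smul_eq_mul, Pi.single_eq_same,
    Pi.single_eq_of_ne hij.symm] at this
  linarith

theorem coordSum_compl {α : Type*} [Finite α] (S : Set α) (x : α → ℝ) :
    coordSum S x + coordSum Sᶜ x = coordSum univ x := by
  classical
  simp only [coordSum_apply]
  rw [← Finset.sum_union (by simp [Set.Finite.disjoint_toFinset, disjoint_compl_right])]
  congr 1
  ext i
  simp [em]

theorem exists_eq_incidence_of_mem_extremePoints {α : Type*} [Finite α] {r b : ℕ} {S : Set α}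
    {x : α → ℝ} (hx : x ∈ (cutHypersimplex r S b).extremePoints ℝ) :
    ∃ B : Set α, B.ncard = r ∧ (B ∩ S).ncard ≤ b ∧ x = incidence B := by
  obtain ⟨hx01, hxr, hxb⟩ := hx.1
  have hint : ∀ i, ¬ (0 < x i ∧ x i < 1) := by
    rintro i ⟨hi0, hi1⟩
    -- With slack, integrality of the total yields a second fractional coordinate. Without it, x(S)
    -- = b and x(Sᶜ) = r - b are both integers, and the second one lies on the same side as the
    -- first.
    rcases hxb.lt_or_eq with hlt | heq
    · obtain ⟨j, -, hj, hj0, hj1⟩ := exists_ne_fractional hx01 (T := univ) (m := r)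
        (by exact_mod_cast hxr) (mem_univ i) hi0 hi1
      exact not_extreme_of_fractional hx hj hi0 hi1 hj0 hj1 (Or.inr hlt)
    · by_cases hi : i ∈ S
      · obtain ⟨j, hjS, hj, hj0, hj1⟩ := exists_ne_fractional hx01 (T := S) (m := b)
          (by exact_mod_cast heq) hi hi0 hi1
        exact not_extreme_of_fractional hx hj hi0 hi1 hj0 hj1 (Or.inl (by simp [hi, hjS]))
      · have hc : coordSum Sᶜ x = ((r - b : ℤ) : ℝ) := by
          have := coordSum_compl S x
          push_cast
          linarith
        obtain ⟨j, hjS, hj, hj0, hj1⟩ := exists_ne_fractional hx01 hc (mem_compl hi) hi0 hi1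
        have hjS' : j ∉ S := hjS
        exact not_extreme_of_fractional hx hj hi0 hi1 hj0 hj1 (Or.inl (by simp [hi, hjS']))
  have hxB : x = incidence {i | x i = 1} := by
    classical
    ext i
    rw [incidence, Set.indicator_apply]
    split_ifs with h
    · exact h
    · by_contra h0
      exact hint i ⟨lt_of_le_of_ne (hx01 i).1 (Ne.symm h0), lt_of_le_of_ne (hx01 i).2 h⟩
  refine ⟨{i | x i = 1}, ?_, ?_, hxB⟩
  · rw [hxB, coordSum_incidence, inter_univ] at hxr
    exact_mod_cast hxr
  · rw [hxB, coordSum_incidence] at hxb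
    exact_mod_cast hxb

theorem IsCutMatroid.basePolytope_eq {α : Type*} [Finite α] {M : Matroid α} {r b : ℕ} {S : Set α}
    (hM : IsCutMatroid M r S b) : basePolytope M = cutHypersimplex r S b := by
  rw [MatroidSplit.basePolytope_eq]
  refine Subset.antisymm (convexHull_min ?_ (convex_cutHypersimplex r S b)) ?_
  · rintro _ ⟨B, hB, rfl⟩
    obtain ⟨h1, h2⟩ := (hM.isBase_iff B).1 hB
    refine ⟨fun i => ?_, ?_, ?_⟩
    · classical
      rw [incidence, Set.indicator_apply]
      split_ifs <;> norm_num
    · rw [coordSum_incidence, inter_univ, h1]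
    · rw [coordSum_incidence]
      exact_mod_cast h2
  · have hfin : (baseVectors M).Finite := (Set.toFinite _).image _
    have hcl : IsClosed (convexHull ℝ (baseVectors M)) := hfin.isClosed_convexHull ℝ
    -- Krein–Milman; the closure is harmless because there are finitely many bases.
    rw [← closure_convexHull_extremePoints (isCompact_cutHypersimplex r S b)
      (convex_cutHypersimplex r S b), ← hcl.closure_eq]
    refine closure_mono (convexHull_mono ?_)
    intro x hx
    obtain ⟨B, h1, h2, rfl⟩ := exists_eq_incidence_of_mem_extremePoints hx
    exact ⟨B, (hM.isBase_iff B).2 ⟨h1, h2⟩, rfl⟩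

/-- The vacuous cut S = ∅, b = 0 describes the whole hypersimplex. Since coordinates sum to r, the
piece of `M₂` is x(S) ≥ b; the common face is exposed by x(S) on one side and by -x(S) on the other.
-/
theorem isHyperplaneSplit_of_isCutMatroid {α : Type*} [Finite α] {M M₁ M₂ : Matroid α} {r b : ℕ}
    {S : Set α} (hb : b ≤ r) (hM : IsCutMatroid M r ∅ 0) (h₁ : IsCutMatroid M₁ r S b)
    (h₂ : IsCutMatroid M₂ r Sᶜ (r - b)) (hex₁ : ∃ B : Set α, B.ncard = r ∧ b < (B ∩ S).ncard)
    (hex₂ : ∃ B : Set α, B.ncard = r ∧ r - b < (B ∩ Sᶜ).ncard) : IsHyperplaneSplit M M₁ M₂ := by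
  have hmem : ∀ x, x ∈ basePolytope M ↔ (∀ i, 0 ≤ x i ∧ x i ≤ 1) ∧ coordSum univ x = r := by
    intro x
    rw [hM.basePolytope_eq]
    simp [cutHypersimplex, coordSum_apply]
  have hmem₁ : ∀ x, x ∈ basePolytope M₁ ↔ x ∈ basePolytope M ∧ coordSum S x ≤ b := by
    intro x
    rw [hmem, h₁.basePolytope_eq]
    exact and_assoc.symm
  have hmem₂ : ∀ x, x ∈ basePolytope M₂ ↔ x ∈ basePolytope M ∧ b ≤ coordSum S x := by
    intro x
    rw [hmem, h₂.basePolytope_eq]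
    refine and_assoc.symm.trans (and_congr_right fun h => ?_)
    have := coordSum_compl S x
    rw [Nat.cast_sub hb]
    constructor <;> intro <;> linarith [h.2]
  refine ⟨h₁.ground.trans hM.ground.symm, h₂.ground.trans hM.ground.symm, ?_, ?_, ?_, ?_, ?_⟩
  · ext x
    rw [mem_union, hmem₁, hmem₂, ← and_or_left]
    exact ⟨fun h => ⟨h, le_total _ _⟩, fun h => h.1⟩
  · rintro ⟨w, hw⟩
    have hwS : coordSum S w = b := le_antisymm ((hmem₁ w).1 hw.1).2 ((hmem₂ w).1 hw.2).2
    refine ⟨coordSum S, Subset.antisymm (fun x hx => ⟨hx.1, fun y hy => ?_⟩) fun x hx => ?_⟩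
    · exact ((hmem₁ y).1 hy).2.trans ((hmem₂ x).1 hx.2).2
    · exact ⟨hx.1, (hmem₂ x).2 ⟨((hmem₁ x).1 hx.1).1, hwS.ge.trans (hx.2 w hw.1)⟩⟩
  · rintro ⟨w, hw⟩
    have hwS : coordSum S w = b := le_antisymm ((hmem₁ w).1 hw.1).2 ((hmem₂ w).1 hw.2).2
    refine ⟨-coordSum S, Subset.antisymm (fun x hx => ⟨hx.2, fun y hy => ?_⟩) fun x hx => ?_⟩
    · exact neg_le_neg (((hmem₁ x).1 hx.1).2.trans ((hmem₂ y).1 hy).2)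
    · exact ⟨(hmem₁ x).2 ⟨((hmem₂ x).1 hx.1).1, (neg_le_neg_iff.1 (hx.2 w hw.2)).trans hwS.le⟩, hx.1⟩
  · intro h
    obtain ⟨B, hB, hlt⟩ := hex₁
    have hBM : M.IsBase B := (hM.isBase_iff B).2 ⟨hB, by simp⟩
    have hB₁ : B ∈ {B | M₁.IsBase B} := h ▸ hBM
    exact absurd ((h₁.isBase_iff B).1 hB₁).2 (not_le.2 hlt)
  · intro h
    obtain ⟨B, hB, hlt⟩ := hex₂
    have hBM : M.IsBase B := (hM.isBase_iff B).2 ⟨hB, by simp⟩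
    have hB₂ : B ∈ {B | M₂.IsBase B} := h ▸ hBM
    exact absurd ((h₂.isBase_iff B).1 hB₂).2 (not_le.2 hlt)

/-! ### Vertex degrees of cut matroids -/

theorem IsCutMatroid.exchanges_eq {α : Type*} [Finite α] {M : Matroid α} {r b : ℕ} {S B : Set α}
    (hM : IsCutMatroid M r S b) (hB : B.ncard = r) (hBS : (B ∩ S).ncard = b) :
    exchanges M B = B ×ˢ Bᶜ \ (B \ S) ×ˢ (S \ B) := by
  ext ⟨e, f⟩
  simp only [exchanges, hM.isBase_iff, mem_ofPred_eq, mem_sdiff, mem_prod, mem_compl_iff, not_and]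
  constructor
  · rintro ⟨he, hf, -, hle⟩
    refine ⟨⟨he, hf⟩, fun h hfS => absurd hf ?_⟩
    rw [ncard_exchange_inter h.2 hf hfS] at hle
    omega
  · rintro ⟨⟨he, hf⟩, h⟩
    refine ⟨he, hf, (Set.ncard_exchange hf he).trans hB, ?_⟩
    rw [← hBS]
    by_cases heS : e ∈ S
    · exact ncard_exchange_inter_of_mem he heS
    · exact ncard_exchange_inter_of_notMem fun hfS => h ⟨he, heS⟩ hfS hf

theorem IsCutMatroid.exchanges_eq_of_lt {α : Type*} [Finite α] {M : Matroid α} {r b : ℕ}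
    {S B : Set α} (hM : IsCutMatroid M r S b) (hB : B.ncard = r) (hBS : (B ∩ S).ncard < b) :
    exchanges M B = B ×ˢ Bᶜ := by
  ext ⟨e, f⟩
  simp only [exchanges, hM.isBase_iff, mem_ofPred_eq, mem_prod, mem_compl_iff]
  constructor
  · rintro ⟨he, hf, -, -⟩
    exact ⟨he, hf⟩
  · rintro ⟨he, hf⟩
    refine ⟨he, hf, (Set.ncard_exchange hf he).trans hB, ?_⟩
    by_cases heS : e ∈ S
    · exact (ncard_exchange_inter_of_mem he heS).trans hBS.le
    by_cases hfS : f ∈ S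
    · rw [ncard_exchange_inter heS hf hfS]
      exact hBS
    · exact (ncard_exchange_inter_of_notMem hfS).trans hBS.le

/-- All vertices on the cut have the same degree, and none off it has a smaller one; `hex`
guarantees that the cut contains a vertex. -/
theorem IsCutMatroid.isLeast_vertexDegrees {α : Type*} [Finite α] {M : Matroid α} {r b : ℕ}
    {S : Set α} (hM : IsCutMatroid M r S b)
    (hex : ∃ B : Set α, B.ncard = r ∧ (B ∩ S).ncard = b) :
    ∃ d, IsLeast (vertexDegrees (FaceLattice (basePolytope M))) d ∧
      d + (r - b) * (S.ncard - b) = r * (Nat.card α - r) := by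
  have hall : ∀ B : Set α, B.ncard = r → (B ×ˢ Bᶜ).ncard = r * (Nat.card α - r) := by
    intro B hB
    rw [Set.ncard_prod, Set.ncard_compl, hB]
  have heq : ∀ B : Set α, B.ncard = r → (B ∩ S).ncard = b →
      (exchanges M B).ncard + (r - b) * (S.ncard - b) = r * (Nat.card α - r) := by
    intro B hB hBS
    have h1 : (B \ S).ncard = r - b := by
      have := Set.ncard_inter_add_ncard_sdiff_eq_ncard B S
      omega
    have h2 : (S \ B).ncard = S.ncard - b := by
      have := Set.ncard_inter_add_ncard_sdiff_eq_ncard S B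
      rw [inter_comm] at this
      omega
    have hsub : (B \ S) ×ˢ (S \ B) ⊆ B ×ˢ Bᶜ := prod_mono sdiff_subset fun x hx => hx.2
    rw [hM.exchanges_eq hB hBS, ← hall B hB, ← Set.ncard_sdiff_add_ncard_of_subset hsub,
      Set.ncard_prod (s := B \ S), h1, h2]
  rw [vertexDegrees_basePolytope]
  obtain ⟨B, hB, hBS⟩ := hex
  refine ⟨(exchanges M B).ncard, ⟨⟨B, (hM.isBase_iff B).2 ⟨hB, hBS.le⟩, rfl⟩, ?_⟩, heq B hB hBS⟩
  rintro _ ⟨C, hC, rfl⟩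
  obtain ⟨hC, hCS⟩ := (hM.isBase_iff C).1 hC
  have h1 := heq B hB hBS
  rcases hCS.lt_or_eq with h | h
  · rw [hM.exchanges_eq_of_lt hC h, hall C hC]
    omega
  · have h2 := heq C hC h
    omega

theorem IsCutMatroid.mul_eq_of_combEquiv {α : Type*} [Finite α] {M M' : Matroid α} {r b b' : ℕ}
    {S S' : Set α} (hM : IsCutMatroid M r S b) (hM' : IsCutMatroid M' r S' b')
    (hex : ∃ B : Set α, B.ncard = r ∧ (B ∩ S).ncard = b)
    (hex' : ∃ B : Set α, B.ncard = r ∧ (B ∩ S').ncard = b')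
    (h : CombEquiv (basePolytope M) (basePolytope M')) :
    (r - b) * (S.ncard - b) = (r - b') * (S'.ncard - b') := by
  obtain ⟨d, hd, h1⟩ := hM.isLeast_vertexDegrees hex
  obtain ⟨d', hd', h2⟩ := hM'.isLeast_vertexDegrees hex'
  rw [h.vertexDegrees_eq] at hd
  have := hd.unique hd'
  omega

/-! ### Uniform matroids -/

theorem exists_ncard_inter_eq {α : Type*} [Finite α] (S : Set α) {r t : ℕ} (ht : t ≤ r)
    (h₁ : t ≤ S.ncard) (h₂ : r - t ≤ Sᶜ.ncard) :
    ∃ B : Set α, B.ncard = r ∧ (B ∩ S).ncard = t ∧ (B ∩ Sᶜ).ncard = r - t := by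
  obtain ⟨A, hAS, hA⟩ := Set.exists_subset_card_eq h₁
  obtain ⟨C, hCS, hC⟩ := Set.exists_subset_card_eq h₂
  have hdisj : Disjoint A C := disjoint_compl_right.mono hAS hCS
  refine ⟨A ∪ C, ?_, ?_, ?_⟩
  · rw [Set.ncard_union_eq hdisj, hA, hC]
    omega
  · rw [union_inter_distrib_right, inter_eq_left.2 hAS,
      (disjoint_compl_left.mono_left hCS).inter_eq, union_empty, hA]
  · rw [union_inter_distrib_right, inter_eq_left.2 hCS,
      (disjoint_compl_right.mono_left hAS).inter_eq, empty_union, hC]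

theorem uniformMatroid_indep_iff {n r : ℕ} (I : Set (Fin n)) :
    (uniformMatroid n r).Indep I ↔ I.ncard ≤ r := Iff.rfl

theorem uniformMatroid_eRk {n r : ℕ} (X : Set (Fin n)) :
    (uniformMatroid n r).eRk X = ((min X.ncard r : ℕ) : ℕ∞) := by
  apply le_antisymm
  · rw [Matroid.eRk_le_iff]
    intro I hI hind
    rw [← (Set.toFinite I).cast_ncard_eq]
    exact_mod_cast le_min (Set.ncard_le_ncard hI) hind
  · obtain ⟨I, hIX, hI⟩ := Set.exists_subset_card_eq (min_le_left X.ncard r)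
    rw [Matroid.le_eRk_iff]
    refine ⟨I, hIX, ?_, ?_⟩
    · rw [uniformMatroid_indep_iff, hI]
      exact min_le_right _ _
    · rw [← (Set.toFinite I).cast_ncard_eq, hI]

theorem isCutMatroid_uniformMatroid {n r : ℕ} (h : r ≤ n) :
    IsCutMatroid (uniformMatroid n r) r ∅ 0 :=
  ⟨rfl, fun B => by simp [uniformMatroid_isBase_iff h]⟩

/-- The integers are aᵢ = rᵢ - bᵢ with b₁ = b and b₂ = r - b, so |X| + aᵢ ≤ rᵢ just says |X| ≤ bᵢ.
-/
theorem isInducedBy_uniformMatroid {n r b : ℕ} {S : Set (Fin n)} {M₁ M₂ : Matroid (Fin n)}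
    (hrn : r ≤ n) (hb : 0 < b) (hbr : b < r) (hbS : b < S.ncard) (hbS' : r - b < Sᶜ.ncard)
    (h₁ : IsCutMatroid M₁ r S b) (h₂ : IsCutMatroid M₂ r Sᶜ (r - b)) :
    IsInducedBy (uniformMatroid n r) S Sᶜ (min S.ncard r - b) (min Sᶜ.ncard r - (r - b))
      M₁ M₂ where
  good :=
    { union_eq := union_compl_self S
      disjoint := disjoint_compl_right
      one_lt_rank_left := by
        rw [uniformMatroid_eRk]
        norm_cast
        omega
      one_lt_rank_right := by
        rw [uniformMatroid_eRk]
        norm_cast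
        omega
      pos_left := by omega
      lt_left := by
        rw [uniformMatroid_eRk]
        norm_cast
        omega
      pos_right := by omega
      lt_right := by
        rw [uniformMatroid_eRk]
        norm_cast
        omega
      rank_add := by
        rw [Matroid.eRank_def, uniformMatroid_eRk, uniformMatroid_eRk, uniformMatroid_eRk,
          show (uniformMatroid n r).E = univ from rfl, Set.ncard_univ, Nat.card_fin]
        norm_cast
        omega
      indep_union := by
        intro X Y _ _ _ _ hX hY
        rw [uniformMatroid_eRk, ← (Set.toFinite _).cast_ncard_eq] at hX hY
        norm_cast at hX hY
        rw [uniformMatroid_indep_iff]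
        have := Set.ncard_union_le X Y
        omega }
  isBase_left B := by
    rw [h₁.isBase_iff, uniformMatroid_isBase_iff hrn, uniformMatroid_eRk,
      ← (Set.toFinite _).cast_ncard_eq]
    norm_cast
    omega
  isBase_right B := by
    rw [h₂.isBase_iff, uniformMatroid_isBase_iff hrn, uniformMatroid_eRk,
      ← (Set.toFinite _).cast_ncard_eq]
    norm_cast
    omega

theorem ncard_initialSegment {n k : ℕ} (h : k ≤ n) : (initialSegment n k).ncard = k := by
  have : initialSegment n k = Set.range (Fin.castLE h) := by
    ext i
    simp [initialSegment, Fin.range_castLE]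
  rw [this, Set.ncard_range_of_injective (Fin.castLE_injective h), Nat.card_fin]

/-! ### Arithmetic of cut levels and defects -/

/-- The position of the hyperplane `x₁ + ⋯ + xₖ = b` splitting the base polytope of `U_{n,r}`. -/
def cutLevel (n r k : ℕ) : ℕ := if 2 * r ≤ n then 1 else k - 1

/-- Level 1 needs r - 1 < n - k, which holds for all k ≤ n/2 when 2r ≤ n but can fail otherwise.
Level k - 1 needs k - 1 < r, which follows from k ≤ n/2 < r when 2r > n, and r + 1 < n. -/
theorem cutLevel_bounds {n r k : ℕ} (hr : 2 ≤ r) (hn : r + 2 ≤ n) (hk : 2 ≤ k) (hkn : k ≤ n / 2) :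
    0 < cutLevel n r k ∧ cutLevel n r k < r ∧ cutLevel n r k < k ∧
      r - cutLevel n r k < n - k := by
  unfold cutLevel
  split_ifs <;> omega

theorem eq_of_mul_eq_mul_of_swap {N c k l : ℤ} (hc : c * k = N - l) (hc' : c * l = N - k)
    (hkl : k ≠ l) : k + l = N := by
  have h : (c - 1) * (k - l) = 0 := by linear_combination hc - hc'
  rcases mul_eq_zero.1 h with h | h
  · have : c = 1 := by linarith
    subst this
    linarith
  · exact absurd (sub_eq_zero.1 h) hkl

theorem eq_of_left_defect_eq {n r k l : ℕ} (hr : 2 ≤ r) (hk : 2 ≤ k) (hkn : k ≤ n / 2)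
    (hl : 2 ≤ l) (hln : l ≤ n / 2)
    (h : (r - cutLevel n r k) * (k - cutLevel n r k) =
      (r - cutLevel n r l) * (l - cutLevel n r l)) : k = l := by
  unfold cutLevel at h
  split_ifs at h
  · have := Nat.eq_of_mul_eq_mul_left (by omega) h
    omega
  -- In this case k, l ≤ n/2 < r, so the subtractions from r are not truncated.
  · rw [show k - (k - 1) = 1 by omega, show l - (l - 1) = 1 by omega] at h
    omega

theorem eq_of_left_defect_eq_right_defect {n r k l : ℕ} (hr : 2 ≤ r) (hn : r + 2 ≤ n)
    (hk : 2 ≤ k) (hkn : k ≤ n / 2) (hl : 2 ≤ l) (hln : l ≤ n / 2)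
    (h : (r - cutLevel n r k) * (k - cutLevel n r k) =
      (r - (r - cutLevel n r l)) * (n - l - (r - cutLevel n r l)))
    (h' : (r - (r - cutLevel n r k)) * (n - k - (r - cutLevel n r k)) =
      (r - cutLevel n r l) * (l - cutLevel n r l)) : k = l := by
  by_contra hkl
  have hkl' : (k : ℤ) ≠ l := by exact_mod_cast hkl
  suffices hsum : (k : ℤ) + l = n by omega
  unfold cutLevel at h h'
  split_ifs at h h'
  -- Level 1: the equations become (r - 1)k = n - l and (r - 1)l = n - k.
  · rw [show r - (r - 1) = 1 by omega, one_mul] at h h'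
    zify [show 1 ≤ r by omega, show 1 ≤ k by omega, show 1 ≤ l by omega, show l ≤ n by omega,
      show k ≤ n by omega, show r - 1 ≤ n - l by omega, show r - 1 ≤ n - k by omega] at h h'
    exact eq_of_mul_eq_mul_of_swap (c := r - 1) (by linear_combination h)
      (by linear_combination -h') hkl'
  -- Levels k - 1 and l - 1: the same system with n - r - 1 in place of r - 1.
  · rw [show k - (k - 1) = 1 by omega, mul_one, show r - (r - (l - 1)) = l - 1 by omega,
      show n - l - (r - (l - 1)) = n - r - 1 by omega] at h
    rw [show l - (l - 1) = 1 by omega, mul_one, show r - (r - (k - 1)) = k - 1 by omega,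
      show n - k - (r - (k - 1)) = n - r - 1 by omega] at h'
    zify [show 1 ≤ k by omega, show 1 ≤ l by omega, show k - 1 ≤ r by omega,
      show l - 1 ≤ r by omega, show r ≤ n by omega, show 1 ≤ n - r by omega] at h h'
    exact eq_of_mul_eq_mul_of_swap (c := n - r - 1) (by linear_combination h')
      (by linear_combination -h) hkl'

/-! ### Counting classes and separating the splits -/

theorem finite_matroid {α : Type*} [Finite α] : Finite (Matroid α) := by
  refine Finite.of_injective (fun M : Matroid α => (M.E, {B | M.IsBase B})) fun M N h => ?_
  rw [Prod.mk.injEq] at h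
  exact Matroid.ext_isBase h.1 fun B _ => Set.ext_iff.1 h.2 B

theorem le_numDifferentSplits {α : Type*} [Finite α] {M : Matroid α} {s : Finset ℕ}
    {M₁ M₂ : ℕ → Matroid α} (hsplit : ∀ k ∈ s, IsHyperplaneSplit M (M₁ k) (M₂ k))
    (hne : ∀ k ∈ s, ∀ l ∈ s, k ≠ l → ¬ SplitEquiv (M₁ k) (M₂ k) (M₁ l) (M₂ l)) :
    s.card ≤ numDifferentSplits M := by
  -- Finiteness is essential: `Nat.card` of an infinite quotient would be 0.
  have := finite_matroid (α := α)
  rw [numDifferentSplits, ← Fintype.card_coe, ← Nat.card_eq_fintype_card]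
  let f : s → Quotient (splitSetoid M) := fun k =>
    Quotient.mk (splitSetoid M) ⟨(M₁ k, M₂ k), hsplit k k.2⟩
  refine Nat.card_le_card_of_injective f fun k l hkl => ?_
  by_contra h
  exact hne k k.2 l l.2 (fun h' => h (Subtype.ext h')) (Quotient.exact hkl)

theorem exists_splits_uniformMatroid {n r k : ℕ} (hr : 2 ≤ r) (hn : r + 2 ≤ n) (hk : 2 ≤ k)
    (hkn : k ≤ n / 2) : ∃ M₁ M₂ : Matroid (Fin n),
      IsCutMatroid M₁ r (initialSegment n k) (cutLevel n r k) ∧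
      IsCutMatroid M₂ r (initialSegment n k)ᶜ (r - cutLevel n r k) ∧
      IsHyperplaneSplit (uniformMatroid n r) M₁ M₂ := by
  obtain ⟨h0, h1, h2, h3⟩ := cutLevel_bounds hr hn hk hkn
  have hS : (initialSegment n k).ncard = k := ncard_initialSegment (by omega)
  have hS' : (initialSegment n k)ᶜ.ncard = n - k := by rw [Set.ncard_compl, hS, Nat.card_fin]
  obtain ⟨B, hB, hB₁, hB₂⟩ := exists_ncard_inter_eq (initialSegment n k) h1.le
    (hS.symm ▸ h2.le) (hS'.symm ▸ h3.le)
  obtain ⟨M₁, hM₁⟩ := exists_isCutMatroid ⟨B, hB, hB₁.le⟩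
  obtain ⟨M₂, hM₂⟩ := exists_isCutMatroid ⟨B, hB, hB₂.le⟩
  refine ⟨M₁, M₂, hM₁, hM₂, isHyperplaneSplit_of_isCutMatroid h1.le
    (isCutMatroid_uniformMatroid (by omega)) hM₁ hM₂ ?_ ?_⟩
  -- An r-set with one element of S more, or below one fewer, than the level lies strictly beyond
  -- the cut, so neither piece has all the bases.
  · obtain ⟨C, hC, hC₁, -⟩ := exists_ncard_inter_eq (initialSegment n k)
      (r := r) (t := cutLevel n r k + 1) (by omega) (by omega) (by omega)
    exact ⟨C, hC, by omega⟩
  · obtain ⟨C, hC, -, hC₂⟩ := exists_ncard_inter_eq (initialSegment n k)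
      (r := r) (t := cutLevel n r k - 1) (by omega) (by omega) (by omega)
    exact ⟨C, hC, by omega⟩

theorem eq_of_splitEquiv {n r k l : ℕ} (hr : 2 ≤ r) (hn : r + 2 ≤ n) (hk : 2 ≤ k)
    (hkn : k ≤ n / 2) (hl : 2 ≤ l) (hln : l ≤ n / 2) {M₁ M₂ N₁ N₂ : Matroid (Fin n)}
    (hM₁ : IsCutMatroid M₁ r (initialSegment n k) (cutLevel n r k))
    (hM₂ : IsCutMatroid M₂ r (initialSegment n k)ᶜ (r - cutLevel n r k))
    (hN₁ : IsCutMatroid N₁ r (initialSegment n l) (cutLevel n r l))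
    (hN₂ : IsCutMatroid N₂ r (initialSegment n l)ᶜ (r - cutLevel n r l))
    (h : SplitEquiv M₁ M₂ N₁ N₂) : k = l := by
  have hcard : ∀ m, 2 ≤ m → m ≤ n / 2 → (initialSegment n m).ncard = m ∧
      (initialSegment n m)ᶜ.ncard = n - m ∧
      ∃ B : Set (Fin n), B.ncard = r ∧ (B ∩ initialSegment n m).ncard = cutLevel n r m ∧
        (B ∩ (initialSegment n m)ᶜ).ncard = r - cutLevel n r m := by
    intro m hm hmn
    obtain ⟨h0, h1, h2, h3⟩ := cutLevel_bounds hr hn hm hmn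
    have hS : (initialSegment n m).ncard = m := ncard_initialSegment (by omega)
    have hS' : (initialSegment n m)ᶜ.ncard = n - m := by rw [Set.ncard_compl, hS, Nat.card_fin]
    exact ⟨hS, hS', exists_ncard_inter_eq _ h1.le (hS.symm ▸ h2.le) (hS'.symm ▸ h3.le)⟩
  obtain ⟨hS, hS', B, hB, hB₁, hB₂⟩ := hcard k hk hkn
  obtain ⟨hT, hT', C, hC, hC₁, hC₂⟩ := hcard l hl hln
  rcases h with ⟨e, -⟩ | ⟨e, e'⟩
  · have h1 := hM₁.mul_eq_of_combEquiv hN₁ ⟨B, hB, hB₁⟩ ⟨C, hC, hC₁⟩ e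
    rw [hS, hT] at h1
    exact eq_of_left_defect_eq hr hk hkn hl hln h1
  · have h1 := hM₁.mul_eq_of_combEquiv hN₂ ⟨B, hB, hB₁⟩ ⟨C, hC, hC₂⟩ e
    have h2 := hM₂.mul_eq_of_combEquiv hN₁ ⟨B, hB, hB₂⟩ ⟨C, hC, hC₁⟩ e'
    rw [hS, hT'] at h1
    rw [hS', hT] at h2
    exact eq_of_left_defect_eq_right_defect hr hn hk hkn hl hln h1 h2

end MatroidSplit

end

theorem corollary3 (n r : ℕ) (hr : 2 ≤ r) (hn : r + 2 ≤ n) :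
    n / 2 - 1 ≤ MatroidSplit.numDifferentSplits (MatroidSplit.uniformMatroid n r) ∧
    ∃ (a₁ a₂ : ℕ → ℕ) (M₁ M₂ : ℕ → Matroid (Fin n)),
      (∀ k : ℕ, 2 ≤ k → k ≤ n / 2 →
        MatroidSplit.IsInducedBy (MatroidSplit.uniformMatroid n r)
            (MatroidSplit.initialSegment n k) (MatroidSplit.initialSegment n k)ᶜ
            (a₁ k) (a₂ k) (M₁ k) (M₂ k) ∧
          MatroidSplit.IsHyperplaneSplit (MatroidSplit.uniformMatroid n r) (M₁ k) (M₂ k)) ∧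
      (∀ k l : ℕ, 2 ≤ k → k ≤ n / 2 → 2 ≤ l → l ≤ n / 2 → k ≠ l →
        ¬ MatroidSplit.SplitEquiv (M₁ k) (M₂ k) (M₁ l) (M₂ l)) := by
  open MatroidSplit in
  have hex : ∀ k, ∃ M₁ M₂ : Matroid (Fin n), 2 ≤ k → k ≤ n / 2 →
      IsCutMatroid M₁ r (initialSegment n k) (cutLevel n r k) ∧
      IsCutMatroid M₂ r (initialSegment n k)ᶜ (r - cutLevel n r k) ∧
      IsHyperplaneSplit (uniformMatroid n r) M₁ M₂ := by
    intro k
    by_cases h : 2 ≤ k ∧ k ≤ n / 2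
    · obtain ⟨M₁, M₂, hM⟩ := exists_splits_uniformMatroid hr hn h.1 h.2
      exact ⟨M₁, M₂, fun _ _ => hM⟩
    · exact ⟨uniformMatroid n r, uniformMatroid n r, fun h1 h2 => absurd ⟨h1, h2⟩ h⟩
  choose M₁ M₂ hM using hex
  have hne : ∀ k l : ℕ, 2 ≤ k → k ≤ n / 2 → 2 ≤ l → l ≤ n / 2 → k ≠ l →
      ¬ MatroidSplit.SplitEquiv (M₁ k) (M₂ k) (M₁ l) (M₂ l) := by
    intro k l hk hkn hl hln hkl h
    obtain ⟨hk₁, hk₂, -⟩ := hM k hk hkn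
    obtain ⟨hl₁, hl₂, -⟩ := hM l hl hln
    exact hkl (MatroidSplit.eq_of_splitEquiv hr hn hk hkn hl hln hk₁ hk₂ hl₁ hl₂ h)
  refine ⟨?_, fun k => min (MatroidSplit.initialSegment n k).ncard r - MatroidSplit.cutLevel n r k,
    fun k => min (MatroidSplit.initialSegment n k)ᶜ.ncard r - (r - MatroidSplit.cutLevel n r k),
    M₁, M₂, fun k hk hkn => ?_, hne⟩
  · have h := MatroidSplit.le_numDifferentSplits (s := Finset.Icc 2 (n / 2))
      (fun k hk => (hM k (Finset.mem_Icc.1 hk).1 (Finset.mem_Icc.1 hk).2).2.2)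
      fun k hk l hl => hne k l (Finset.mem_Icc.1 hk).1 (Finset.mem_Icc.1 hk).2
        (Finset.mem_Icc.1 hl).1 (Finset.mem_Icc.1 hl).2
    rw [Nat.card_Icc] at h
    omega
  · obtain ⟨hk₁, hk₂, hsplit⟩ := hM k hk hkn
    obtain ⟨h0, h1, h2, h3⟩ := MatroidSplit.cutLevel_bounds hr hn hk hkn
    have hS : (MatroidSplit.initialSegment n k).ncard = k :=
      MatroidSplit.ncard_initialSegment (by omega)
    refine ⟨MatroidSplit.isInducedBy_uniformMatroid (by omega) h0 h1 (hS.symm ▸ h2) ?_ hk₁ hk₂,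
      hsplit⟩
    rw [Set.ncard_compl, hS, Nat.card_fin]
    exact h3
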